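/- For a real number $\lambda$ and a positive integer $n$, let $\mathcal{F}_{\lambda,n}$ be the family of all subsets of $\{1,\dots,n\}$ of size at most $\lambda n$. A sequence of integers $\Sigma=(a_1,\dots,a_n)$ is called $M$-bounded if $0\le a_i\le M$ for all $i$, and $\mathcal{F}_{\lambda,n}$-sum distinct if $\sum_{i\in A_1}a_i\neq\sum_{i\in A_2}a_i$ for all distinct $A_1,A_2\in\mathcal{F}_{\lambda,n}$. Theorem. (1) For every $\lambda<1/4$ there is $N=N(\lambda)$ such that for every $n\ge N$ there exists a sequence $(a_1,\dots,a_n)$ of $\left(\frac{0.22096}{2}\cdot 2^n\right)$-bounded integers that is $\mathcal{F}_{\lambda,n}$-sum distinct. (2) For every $\lambda<1/8$ there is $N=N(\lambda)$ such that for every $n\ge N$ there exists a sequence $(a_1,\dots,a_n)$ of $\left(\frac{0.22096}{4}\cdot 2^n\right)$-bounded integers that is $\mathcal{F}_{\lambda,n}$-sum distinct. -/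

import Mathlib

/-- The family of all subsets of an `n`-element index set whose size is at most `lam * n`. -/
def smallSubsets (lam : ℝ) (n : ℕ) : Set (Finset (Fin n)) :=
  {A | (A.card : ℝ) ≤ lam * n}

/-- The subset sum `S(A) = ∑ i ∈ A, a i`. -/
def subsetSum {n : ℕ} (a : Fin n → ℤ) (A : Finset (Fin n)) : ℤ :=
  ∑ i ∈ A, a i

/-- Distinct members of the family of subsets of size at most `lam * n` have distinct sums. -/
def IsSumDistinct (lam : ℝ) {n : ℕ} (a : Fin n → ℤ) : Prop :=
  ∀ A₁ ∈ smallSubsets lam n, ∀ A₂ ∈ smallSubsets lam n,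
    A₁ ≠ A₂ → subsetSum a A₁ ≠ subsetSum a A₂

/-- Every term of the integer sequence lies in the real interval `[0, M]`. -/
def IsBoundedBy (M : ℝ) {n : ℕ} (a : Fin n → ℤ) : Prop :=
  ∀ i, (a i : ℝ) ∈ Set.Icc (0 : ℝ) M

/-!
Write `j = n - 6` or `j = n - 7`. The sequences consist of the powers `2 ^ i` for `i < j`, of the
sum-distinct set `{3, 5, 6, 7}` scaled by `2 ^ j`, and of two or three further terms which are
multiples of an inverse `v` of `5` modulo a power of two. Two subsets with equal sums yield a
vanishing combination of the terms with coefficients `e i ∈ {-1, 0, 1}`, and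
`∑ |e i|` is at most the sum of the two sizes, hence at most `2 * lam * n`.

The point is that the integers `r * v` with `0 < |r| ≤ 3` are as far as possible from being sparse
in signed binary: if `∑ i < m, e i * 2 ^ i` is congruent to `r * v` modulo `2 ^ m`, then about `m / 2`
of the `e i` are nonzero (`le_two_mul_sum_abs_of_dvd`). So `v` and `2 * v`, whose nontrivial signed
combinations are of this form, can both be added to the first `j + 4` terms as long as
`2 * lam * n` is smaller than about `n / 2`; this is the first assertion. For the second one, `v` is
an inverse of `5` modulo `2 ^ h` with `h` about `n / 2`, and a third term `2 ^ h * v` is placed on the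
next `h` binary digits; every nontrivial combination of the three then needs about `n / 4` nonzero
signed digits.

The largest term is `7 * 2 ^ j`, and `7 / 2 ^ 6 ≤ 0.22096 / 2`, `7 / 2 ^ 7 ≤ 0.22096 / 4`.
-/

/-- Splitting off the lowest digit of a binary expansion. -/
theorem sum_signed_digits_succ (m : ℕ) (e : ℕ → ℤ) :
    ∑ i ∈ Finset.range (m + 1), e i * 2 ^ i
      = 2 * (∑ i ∈ Finset.range m, e (i + 1) * 2 ^ i) + e 0 := by
  rw [Finset.sum_range_succ', Finset.mul_sum]
  simp only [pow_succ, pow_zero, mul_one]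
  congr 1
  exact Finset.sum_congr rfl fun i _ => by ring

/-- Signed binary digits of a multiple of `2 ^ m` below position `m` all vanish. -/
theorem signed_digits_eq_zero_of_dvd (m : ℕ) (e : ℕ → ℤ) (he : ∀ i, |e i| ≤ 1)
    (h : (2 : ℤ) ^ m ∣ ∑ i ∈ Finset.range m, e i * 2 ^ i) : ∀ i < m, e i = 0 := by
  induction m generalizing e with
  | zero => simp
  | succ m ih =>
    rw [sum_signed_digits_succ, pow_succ'] at h
    have h0 : e 0 = 0 := by
      have h2 := (dvd_mul_right (2 : ℤ) (2 ^ m)).trans h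
      have := abs_le.1 (he 0)
      omega
    rw [h0, add_zero] at h
    have h' := ih (fun i => e (i + 1)) (fun i => he _)
      (Int.dvd_of_mul_dvd_mul_left (by norm_num) h)
    rintro (_ | i) hi
    · exact h0
    · exact h' i (by omega)

/-- Every signed binary expansion of `r / 5` modulo `2 ^ m` has about `m / 2` nonzero digits. Removing
the lowest digit `d` replaces `r` by `(r - 5 * d) / 2`, which again lies in `{±1, ±2, ±3, ±4}`; the
term `|r| / 2` (rounded down) is a potential for which every such step has amortized cost at least
`1 / 2`. -/
theorem le_two_mul_sum_abs_of_dvd (m : ℕ) (e : ℕ → ℤ) (he : ∀ i, |e i| ≤ 1) (r : ℤ)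
    (hr : r ≠ 0) (hr4 : |r| ≤ 4)
    (h : (2 : ℤ) ^ m ∣ 5 * (∑ i ∈ Finset.range m, e i * 2 ^ i) - r) :
    (m : ℤ) ≤ 2 * (∑ i ∈ Finset.range m, |e i|) + |r| / 2 := by
  induction m generalizing e r with
  | zero => simpa using Int.ediv_nonneg (abs_nonneg r) (by norm_num)
  | succ m ih =>
    rw [sum_signed_digits_succ] at h
    rw [Finset.sum_range_succ']
    have he0 := abs_le.1 (he 0)
    have hr4' := abs_le.1 hr4
    obtain ⟨s, hs⟩ : ∃ s, r - 5 * e 0 = 2 * s := by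
      have h2 := (dvd_pow_self (2 : ℤ) (Nat.succ_ne_zero m)).trans h
      exact ⟨(r - 5 * e 0) / 2, by omega⟩
    have hs0 : s ≠ 0 := by omega
    have hs4 : |s| ≤ 4 := abs_le.2 (by omega)
    have hd : (2 : ℤ) ^ m ∣ 5 * (∑ i ∈ Finset.range m, e (i + 1) * 2 ^ i) - s := by
      apply Int.dvd_of_mul_dvd_mul_left (a := 2) (by norm_num)
      rw [← pow_succ']
      convert h using 1
      linarith
    have := ih (fun i => e (i + 1)) (fun i => he _) s hs0 hs4 hd
    push_cast
    have hstep : 1 + |s| / 2 ≤ 2 * |e 0| + |r| / 2 := by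
      have hs4' := abs_le.1 hs4
      obtain ⟨hs4l, hs4u⟩ := hs4'
      obtain rfl : r = 2 * s + 5 * e 0 := by linarith
      have hcases : e 0 = -1 ∨ e 0 = 0 ∨ e 0 = 1 := by omega
      rcases hcases with h0 | h0 | h0 <;> rw [h0] at hr4' ⊢ <;> interval_cases s <;>
        first | omega | norm_num
    linarith

/-- An inverse of `5` modulo `2 ^ m`, as a reduced residue. -/
theorem exists_inverse_five_mod_two_pow (m : ℕ) :
    ∃ v : ℤ, 0 ≤ v ∧ v < 2 ^ m ∧ (2 : ℤ) ^ m ∣ 5 * v - 1 := by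
  have hc : IsCoprime (5 : ℤ) (2 ^ m) := IsCoprime.pow_right ⟨1, -2, by norm_num⟩
  obtain ⟨a, b, hab⟩ := hc
  refine ⟨a % 2 ^ m, Int.emod_nonneg _ (by positivity), Int.emod_lt_of_pos _ (by positivity), ?_⟩
  refine ⟨-b - 5 * (a / 2 ^ m), ?_⟩
  linear_combination 5 * Int.emod_add_mul_ediv a (2 ^ m) + hab

/-- Sum-distinctness follows from the absence of nontrivial relations with coefficients in
`{-1, 0, 1}` and few nonzero coefficients. The coefficients are those of `𝟙_{A₁} - 𝟙_{A₂}`. -/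
theorem isSumDistinct_of_no_sparse_relation (lam : ℝ) (n : ℕ) (f : ℕ → ℤ)
    (h : ∀ e : ℕ → ℤ, (∀ i, |e i| ≤ 1) → ∑ i ∈ Finset.range n, e i * f i = 0 →
      ((∑ i ∈ Finset.range n, |e i| : ℤ) : ℝ) ≤ 2 * lam * n → ∀ i < n, e i = 0) :
    IsSumDistinct lam (fun i : Fin n => f i) := by
  intro A₁ h₁ A₂ h₂ hne heq
  apply hne
  let χ : Finset (Fin n) → Fin n → ℤ := fun A i => if i ∈ A then 1 else 0
  let e : ℕ → ℤ := fun i => if hi : i < n then χ A₁ ⟨i, hi⟩ - χ A₂ ⟨i, hi⟩ else 0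
  have hχ : ∀ A i, 0 ≤ χ A i ∧ χ A i ≤ 1 := by
    intro A i
    by_cases hi : i ∈ A <;> simp [χ, hi]
  have hval : ∀ i : Fin n, e i = χ A₁ i - χ A₂ i := fun i => by simp [e]
  have hcard : ∀ A, ∑ i, χ A i = A.card := fun A => by simp [χ]
  have hsub : ∀ A, ∑ i, χ A i * f i = subsetSum (fun i : Fin n => f i) A := fun A => by
    simp [χ, subsetSum]
  have hz := h e ?_ ?_ ?_
  · ext i
    have := hz i i.2
    rw [hval] at this
    by_cases hi₁ : i ∈ A₁ <;> by_cases hi₂ : i ∈ A₂ <;> simp [χ, hi₁, hi₂] at this ⊢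
  · intro i
    by_cases hi : i < n
    · have := hχ A₁ ⟨i, hi⟩
      have := hχ A₂ ⟨i, hi⟩
      simp only [e, hi, dif_pos]
      exact abs_le.2 (by omega)
    · simp [e, hi]
  · rw [← Fin.sum_univ_eq_sum_range (fun i => e i * f i)]
    simp only [hval, sub_mul, Finset.sum_sub_distrib, hsub]
    exact sub_eq_zero.2 heq
  · have hle : ∑ i ∈ Finset.range n, |e i| ≤ A₁.card + A₂.card := by
      rw [← Fin.sum_univ_eq_sum_range (fun i => |e i|), ← hcard, ← hcard, ← Finset.sum_add_distrib]
      refine Finset.sum_le_sum fun i _ => ?_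
      have := hχ A₁ i
      have := hχ A₂ i
      rw [hval]
      exact abs_le.2 (by omega)
    have hle' : ((∑ i ∈ Finset.range n, |e i| : ℤ) : ℝ) ≤ A₁.card + A₂.card := by exact_mod_cast hle
    have h₁' : (A₁.card : ℝ) ≤ lam * n := h₁
    have h₂' : (A₂.card : ℝ) ≤ lam * n := h₂
    linarith

/-- The powers `2 ^ i` for `i < j`, followed by `tail 0, tail 1, …`. -/
def powersThen (j : ℕ) (tail : ℕ → ℤ) (i : ℕ) : ℤ :=
  if i < j then 2 ^ i else tail (i - j)

/-- A signed combination of `powersThen j tail`, split into its two parts. -/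
theorem sum_powersThen (j k : ℕ) (tail e : ℕ → ℤ) :
    ∑ i ∈ Finset.range (j + k), e i * powersThen j tail i
      = (∑ i ∈ Finset.range j, e i * 2 ^ i)
        + ∑ i ∈ Finset.range k, e (j + i) * tail i := by
  rw [Finset.sum_range_add]
  congr 1
  · refine Finset.sum_congr rfl fun i hi => ?_
    simp [powersThen, Finset.mem_range.1 hi]
  · exact Finset.sum_congr rfl fun i _ => by simp [powersThen]

/-- The constant `7` is the largest element of `{3, 5, 6, 7}`. -/
theorem isBoundedBy_powersThen (j k : ℕ) (tail : ℕ → ℤ)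
    (ht : ∀ i < k, 0 ≤ tail i ∧ tail i ≤ 7 * 2 ^ j) (M : ℝ) (hM : 7 * 2 ^ j ≤ M) :
    IsBoundedBy M (fun i : Fin (j + k) => powersThen j tail i) := by
  intro i
  have key : 0 ≤ powersThen j tail i ∧ powersThen j tail i ≤ 7 * 2 ^ j := by
    by_cases hi : (i : ℕ) < j
    · have h1 : (2 : ℤ) ^ (i : ℕ) ≤ 2 ^ j := pow_le_pow_right₀ (by norm_num) hi.le
      have h2 : (0 : ℤ) < 2 ^ (i : ℕ) := by positivity
      simp only [powersThen, hi, if_true]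
      constructor <;> linarith
    · simp only [powersThen, hi, if_false]
      exact ht _ (by omega)
  refine ⟨by exact_mod_cast key.1, le_trans ?_ hM⟩
  exact_mod_cast key.2

/-- The set `{3, 5, 6, 7}` has distinct subset sums, and stays sum-distinct when it is scaled by
`2 ^ j` and the powers `2 ^ i` with `i < j` are added. -/
theorem powers_and_scaled_block_independent (j : ℕ) (e : ℕ → ℤ) (he : ∀ i, |e i| ≤ 1)
    (h : (∑ i ∈ Finset.range j, e i * 2 ^ i)
      + 2 ^ j * (3 * e j + 5 * e (j + 1) + 6 * e (j + 2) + 7 * e (j + 3)) = 0) :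
    ∀ i < j + 4, e i = 0 := by
  have hlow := signed_digits_eq_zero_of_dvd j e he
    ((dvd_add_left (dvd_mul_right _ _)).1 (h ▸ dvd_zero _))
  rw [Finset.sum_eq_zero fun i hi => by rw [hlow i (Finset.mem_range.1 hi), zero_mul], zero_add,
    mul_eq_zero, or_iff_right (by positivity)] at h
  have h0 := abs_le.1 (he j)
  have h1 := abs_le.1 (he (j + 1))
  have h2 := abs_le.1 (he (j + 2))
  have h3 := abs_le.1 (he (j + 3))
  have hb : e j = 0 ∧ e (j + 1) = 0 ∧ e (j + 2) = 0 ∧ e (j + 3) = 0 := by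
    have hc2 : e (j + 2) = -1 ∨ e (j + 2) = 0 ∨ e (j + 2) = 1 := by omega
    have hc3 : e (j + 3) = -1 ∨ e (j + 3) = 0 ∨ e (j + 3) = 1 := by omega
    rcases hc2 with hc2 | hc2 | hc2 <;> rcases hc3 with hc3 | hc3 | hc3 <;> omega
  intro i hi
  rcases lt_or_ge i j with hij | hij
  · exact hlow i hij
  · obtain ⟨d, rfl⟩ := Nat.exists_eq_add_of_le hij
    have hd : d < 4 := by omega
    interval_cases d
    exacts [hb.1, hb.2.1, hb.2.2.1, hb.2.2.2]

/-- The last six terms of the sequence for the first assertion. -/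
def twoMultiplesTail (j : ℕ) (v : ℤ) : ℕ → ℤ
  | 0 => 3 * 2 ^ j
  | 1 => 5 * 2 ^ j
  | 2 => 6 * 2 ^ j
  | 3 => 7 * 2 ^ j
  | 4 => v
  | _ => 2 * v

/-- The last seven terms of the sequence for the second assertion. -/
def threeMultiplesTail (j h : ℕ) (v : ℤ) : ℕ → ℤ
  | 0 => 3 * 2 ^ j
  | 1 => 5 * 2 ^ j
  | 2 => 6 * 2 ^ j
  | 3 => 7 * 2 ^ j
  | 4 => v
  | 5 => 2 * v
  | _ => 2 ^ h * v

/-- A nontrivial relation between the terms of the first sequence has at least about `j / 2` nonzero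
coefficients. -/
theorem relation_twoMultiples (j : ℕ) (v : ℤ) (hv : (2 : ℤ) ^ j ∣ 5 * v - 1) (e : ℕ → ℤ)
    (he : ∀ i, |e i| ≤ 1)
    (h : ∑ i ∈ Finset.range (j + 6), e i * powersThen j (twoMultiplesTail j v) i = 0)
    (hw : 2 * (∑ i ∈ Finset.range (j + 6), |e i|) + 1 < j) : ∀ i < j + 6, e i = 0 := by
  rw [sum_powersThen] at h
  simp only [Finset.sum_range_succ, Finset.sum_range_zero, twoMultiplesTail, zero_add,
    add_zero] at h
  have h4 := abs_le.1 (he (j + 4))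
  have h5 := abs_le.1 (he (j + 5))
  set S := ∑ i ∈ Finset.range j, e i * 2 ^ i with hS
  have hWj : ∑ i ∈ Finset.range j, |e i| ≤ ∑ i ∈ Finset.range (j + 6), |e i| :=
    Finset.sum_le_sum_of_subset_of_nonneg (Finset.range_mono (by omega)) fun _ _ _ => abs_nonneg _
  have hr : e (j + 4) + 2 * e (j + 5) = 0 := by
    by_contra hr
    have habs : |(-(e (j + 4) + 2 * e (j + 5)))| ≤ 3 := abs_le.2 (by omega)
    have := le_two_mul_sum_abs_of_dvd j e he (-(e (j + 4) + 2 * e (j + 5))) (by omega)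
      (by omega) (by
        obtain ⟨q, hq⟩ := hv
        refine ⟨-(5 * (3 * e j + 5 * e (j + 1) + 6 * e (j + 2) + 7 * e (j + 3)))
          - (e (j + 4) + 2 * e (j + 5)) * q, ?_⟩
        rw [← hS]
        linear_combination 5 * h - (e (j + 4) + 2 * e (j + 5)) * hq)
    omega
  have hlow := powers_and_scaled_block_independent j e he
    (by rw [← hS]; linear_combination h - v * hr)
  intro i hi
  rcases lt_or_ge i (j + 4) with hij | hij
  · exact hlow i hij
  · have : i = j + 4 ∨ i = j + 5 := by omega
    rcases this with rfl | rfl <;> omega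

/-- A nontrivial relation between the terms of the second sequence has at least about `h / 2` nonzero
coefficients: the digits below `h` see only `v` and `2 * v`, and when these two do not occur, the
digits from `h` to `2 * h` see `2 ^ h * v`. -/
theorem relation_threeMultiples (j h : ℕ) (hj : 2 * h ≤ j) (v : ℤ)
    (hv : (2 : ℤ) ^ h ∣ 5 * v - 1) (e : ℕ → ℤ) (he : ∀ i, |e i| ≤ 1)
    (hrel : ∑ i ∈ Finset.range (j + 7), e i * powersThen j (threeMultiplesTail j h v) i = 0)
    (hw : 2 * (∑ i ∈ Finset.range (j + 7), |e i|) + 1 < h) : ∀ i < j + 7, e i = 0 := by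
  rw [sum_powersThen] at hrel
  simp only [Finset.sum_range_succ, Finset.sum_range_zero, threeMultiplesTail, zero_add,
    add_zero] at hrel
  have h4 := abs_le.1 (he (j + 4))
  have h5 := abs_le.1 (he (j + 5))
  have h6 := abs_le.1 (he (j + 6))
  obtain ⟨g, rfl⟩ := Nat.exists_eq_add_of_le hj
  set j := 2 * h + g with hjdef
  set S := ∑ i ∈ Finset.range j, e i * 2 ^ i with hS
  set U := 3 * e j + 5 * e (j + 1) + 6 * e (j + 2) + 7 * e (j + 3) with hU
  set S₀ := ∑ i ∈ Finset.range h, e i * 2 ^ i with hS₀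
  set S₁ := ∑ i ∈ Finset.range h, e (h + i) * 2 ^ i with hS₁
  have hsplit : S = S₀ + 2 ^ h * S₁
      + 2 ^ h * 2 ^ h * ∑ i ∈ Finset.range g, e (h + h + i) * 2 ^ i := by
    rw [hS, hjdef, two_mul, Finset.sum_range_add, Finset.sum_range_add, hS₁, Finset.mul_sum,
      Finset.mul_sum]
    refine congr_arg₂ _ (congr_arg₂ _ rfl ?_) ?_ <;>
      exact Finset.sum_congr rfl fun i _ => by ring
  set S₂ := ∑ i ∈ Finset.range g, e (h + h + i) * 2 ^ i
  have hpow : (2 : ℤ) ^ j = 2 ^ h * 2 ^ h * 2 ^ g := by rw [hjdef, two_mul, pow_add, pow_add]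
  have hW₀ : ∑ i ∈ Finset.range h, |e i| ≤ ∑ i ∈ Finset.range (j + 7), |e i| :=
    Finset.sum_le_sum_of_subset_of_nonneg (Finset.range_mono (by omega)) fun _ _ _ => abs_nonneg _
  have hW₁ : ∑ i ∈ Finset.range h, |e (h + i)| ≤ ∑ i ∈ Finset.range (j + 7), |e i| := by
    have h1 : ∑ i ∈ Finset.range (h + h), |e i| ≤ ∑ i ∈ Finset.range (j + 7), |e i| :=
      Finset.sum_le_sum_of_subset_of_nonneg (Finset.range_mono (by omega))
        fun _ _ _ => abs_nonneg _
    rw [Finset.sum_range_add] at h1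
    have h2 : 0 ≤ ∑ i ∈ Finset.range h, |e i| := Finset.sum_nonneg fun _ _ => abs_nonneg _
    linarith
  have hr : e (j + 4) + 2 * e (j + 5) = 0 := by
    by_contra hr
    have habs : |(-(e (j + 4) + 2 * e (j + 5)))| ≤ 3 := abs_le.2 (by omega)
    have := le_two_mul_sum_abs_of_dvd h e he (-(e (j + 4) + 2 * e (j + 5))) (by omega)
      (by omega) (by
        obtain ⟨q, hq⟩ := hv
        refine ⟨-(5 * (S₁ + 2 ^ h * S₂ + 2 ^ h * 2 ^ g * U + e (j + 6) * v))
          - (e (j + 4) + 2 * e (j + 5)) * q, ?_⟩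
        rw [← hS₀]
        linear_combination 5 * hrel - (e (j + 4) + 2 * e (j + 5)) * hq - 5 * hsplit - 5 * U * hpow)
    omega
  have hr' : e (j + 6) = 0 := by
    by_contra hr'
    have hlow := signed_digits_eq_zero_of_dvd h e he
      ⟨-(S₁ + 2 ^ h * S₂ + 2 ^ h * 2 ^ g * U + e (j + 6) * v), by
        rw [← hS₀]
        linear_combination hrel - v * hr - hsplit - U * hpow⟩
    have hS₀0 : S₀ = 0 :=
      Finset.sum_eq_zero fun i hi => by rw [hlow i (Finset.mem_range.1 hi), zero_mul]
    have hmid : S₁ + 2 ^ h * (S₂ + 2 ^ g * U) + e (j + 6) * v = 0 := by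
      have hne : (2 : ℤ) ^ h ≠ 0 := by positivity
      apply (mul_eq_zero.1 _).resolve_left hne
      linear_combination hrel - v * hr - hsplit - U * hpow - hS₀0
    have habs : |(-e (j + 6))| ≤ 1 := abs_le.2 (by omega)
    have := le_two_mul_sum_abs_of_dvd h (fun i => e (h + i)) (fun i => he _) (-e (j + 6))
      (by omega) (by omega) (by
        obtain ⟨q, hq⟩ := hv
        refine ⟨-(5 * (S₂ + 2 ^ g * U)) - e (j + 6) * q, ?_⟩
        rw [← hS₁]
        linear_combination 5 * hmid - e (j + 6) * hq)
    omega
  have hlow := powers_and_scaled_block_independent j e he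
    (by rw [← hS, ← hU]; linear_combination hrel - v * hr - 2 ^ h * v * hr')
  intro i hi
  rcases lt_or_ge i (j + 4) with hij | hij
  · exact hlow i hij
  · have : i = j + 4 ∨ i = j + 5 ∨ i = j + 6 := by omega
    rcases this with rfl | rfl | rfl <;> omega

theorem mainTheorem4 :
    (∀ lam : ℝ, lam < 1 / 4 → ∃ N : ℕ, ∀ n : ℕ, N ≤ n →
      ∃ a : Fin n → ℤ,
        IsBoundedBy ((0.22096 : ℝ) / 2 * 2 ^ n) a ∧ IsSumDistinct lam a) ∧
    (∀ lam : ℝ, lam < 1 / 8 → ∃ N : ℕ, ∀ n : ℕ, N ≤ n →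
      ∃ a : Fin n → ℤ,
        IsBoundedBy ((0.22096 : ℝ) / 4 * 2 ^ n) a ∧ IsSumDistinct lam a) := by
  constructor
  · intro lam hlam
    -- For `n = j + 6`, the inequality `n > 7 / (1 - 4 * lam)` says `4 * lam * n + 1 < j`.
    obtain ⟨N, hN⟩ := exists_nat_gt (7 / (1 - 4 * lam))
    refine ⟨N + 6, fun n hn => ?_⟩
    obtain ⟨j, rfl⟩ := Nat.exists_eq_add_of_le' (le_of_add_le_right hn)
    obtain ⟨v, hv0, hv1, hv⟩ := exists_inverse_five_mod_two_pow j
    refine ⟨fun i => powersThen j (twoMultiplesTail j v) i,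
      isBoundedBy_powersThen j 6 _ ?_ _ ?_, isSumDistinct_of_no_sparse_relation lam _ _ ?_⟩
    · intro i hi
      interval_cases i <;> simp only [twoMultiplesTail] <;> constructor <;> linarith
    · have : (0 : ℝ) < 2 ^ j := by positivity
      rw [pow_add]
      linarith
    · intro e he hrel hw
      refine relation_twoMultiples j v hv e he hrel ?_
      have hNn : (N : ℝ) ≤ (j + 6 : ℕ) := by exact_mod_cast (by omega : N ≤ j + 6)
      have hpos : 0 < 1 - 4 * lam := by linarith
      have hbig := (div_lt_iff₀ hpos).1 (hN.trans_le hNn)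
      have : 2 * ((∑ i ∈ Finset.range (j + 6), |e i| : ℤ) : ℝ) + 1 < j := by
        push_cast at hbig hw ⊢
        linarith
      exact_mod_cast this
  · intro lam hlam
    -- For `n = j + 7` and `j ≤ 2 * h + 1`, the inequality `n > 10 / (1 - 8 * lam)` gives
    -- `4 * lam * n + 1 < h`.
    obtain ⟨N, hN⟩ := exists_nat_gt (10 / (1 - 8 * lam))
    refine ⟨N + 7, fun n hn => ?_⟩
    obtain ⟨j, rfl⟩ := Nat.exists_eq_add_of_le' (le_of_add_le_right hn)
    obtain ⟨h, hh, hh'⟩ : ∃ h, 2 * h ≤ j ∧ j ≤ 2 * h + 1 := ⟨j / 2, by omega, by omega⟩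
    obtain ⟨v, hv0, hv1, hv⟩ := exists_inverse_five_mod_two_pow h
    have hpow1 : (2 : ℤ) ^ h ≤ 2 ^ j := pow_le_pow_right₀ (by norm_num) (by omega)
    have hpow2 : (2 : ℤ) ^ h * v ≤ 2 ^ j := by
      calc (2 : ℤ) ^ h * v ≤ 2 ^ h * 2 ^ h := by gcongr
        _ = 2 ^ (2 * h) := by rw [two_mul, pow_add]
        _ ≤ 2 ^ j := pow_le_pow_right₀ (by norm_num) hh
    have hpow3 : 0 ≤ (2 : ℤ) ^ h * v := by positivity
    refine ⟨fun i => powersThen j (threeMultiplesTail j h v) i,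
      isBoundedBy_powersThen j 7 _ ?_ _ ?_, isSumDistinct_of_no_sparse_relation lam _ _ ?_⟩
    · intro i hi
      interval_cases i <;> simp only [threeMultiplesTail] <;> constructor <;> linarith
    · have : (0 : ℝ) < 2 ^ j := by positivity
      rw [pow_add]
      linarith
    · intro e he hrel hw
      refine relation_threeMultiples j h hh v hv e he hrel ?_
      have hNn : (N : ℝ) ≤ (j + 7 : ℕ) := by exact_mod_cast (by omega : N ≤ j + 7)
      have hpos : 0 < 1 - 8 * lam := by linarith
      have hbig := (div_lt_iff₀ hpos).1 (hN.trans_le hNn)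
      have hjh : (j : ℝ) ≤ 2 * h + 1 := by exact_mod_cast hh'
      have : 2 * ((∑ i ∈ Finset.range (j + 7), |e i| : ℤ) : ℝ) + 1 < h := by
        push_cast at hbig hw ⊢
        linarith
      exact_mod_cast this
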